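/- Let $\mathcal A=M_2(\mathbb H)\oplus M_4(\mathbb C)$, a real involutive algebra. Let $V=\mathbb C^4$, and let $W=\mathbb H^2$, regarded as a $4$-dimensional complex vector space on which $M_2(\mathbb H)$ acts. Let $\mathcal H=\mathrm{Hom}_{\mathbb C}(V,W)\oplus \mathrm{Hom}_{\mathbb C}(W,V)$ be the $32$-dimensional Hilbert space (Hilbert--Schmidt inner product) on which $\mathcal A$ acts by left multiplication, $(a,b)(x,y)=(ax,by)$. Equip $\mathcal H$ with the antilinear isometry $J(x,y)=(y^*,x^*)$ and the grading $\gamma(x,y)=(\Gamma x,-y\Gamma)$, where $\Gamma$ is the grading of $W=\mathbb H\oplus\mathbb H$ equal to $-1$ on the first and $+1$ on the second summand (so $J^2=1$, $J\gamma=-\gamma J$: KO-dimension $6$). The even part of $\mathcal A$ (the elements commuting with $\gamma$) is $\mathcal A^{\mathrm{ev}}=\mathbb H\oplus\mathbb H\oplus M_4(\mathbb C)$. For an operator $T$ on $\mathcal H$ write $T^0=JT^*J^{-1}$. An involutive (real, not necessarily unital) subalgebra $\mathcal B\subset\mathcal A^{\mathrm{ev}}$ is said to admit an off-diagonal Dirac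 operator if there is a linear operator $D$ on $\mathcal H$ with $D=D^*$, $JD=DJ$, $D\gamma=-\gamma D$, which satisfies the order one condition $[[D,a],b^0]=0$ for all $a,b\in\mathcal B$ and does not commute with the center of $\mathcal A$, i.e. $[D,Z(\mathcal A)]\neq\{0\}$. Theorem. Up to an automorphism of $\mathcal A^{\mathrm{ev}}$ there is a unique involutive subalgebra $\mathcal A_F\subset\mathcal A^{\mathrm{ev}}$ of maximal dimension among those that admit an off-diagonal Dirac operator. Precisely, let $$\mathcal A_F=\{(\lambda\oplus q,\ \lambda\oplus m)\;:\;\lambda\in\mathbb C,\ q\in\mathbb H,\ m\in M_3(\mathbb C)\}\subset\mathbb H\oplus\mathbb H\oplus M_4(\mathbb C),$$ where $\mathbb C$ is embedded in $\mathbb H$ by $x+iy\mapsto x+yi$. Then $\mathcal A_F$ admits an off-diagonal Dirac operator and its real dimension is the largest possible; and every involutive subalgebra which admits an off-diagonal Dirac operator and has this largest dimension is the image of $\mathcal A_F$ under a $*$-automorphism of the real algebra $\mathcal A^{\mathrm{ev}}$. Moreover $\mathcal A_F$ is isomorphic, as a real involutive algebra, to $\mathbb C\oplus\mathbb H\oplus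 M_3(\mathbb C)$, and together with its representation in $(\mathcal H,J,\gamma)$ it is the finite noncommutative space of one generation of the Standard Model: there are a $*$-isomorphism $\psi:\mathcal A_F\to\mathbb C\oplus\mathbb H\oplus M_3(\mathbb C)$ and a unitary from $\mathcal H$ onto the space spanned by the $16$ fermions of one generation (left/right chirality, isospin up/down, lepton or quark of one of $3$ colors) and their $16$ antiparticles, intertwining (via $\psi$) the action of $\mathcal A_F$ with the action in which $(\lambda,q,m)$ acts by $q$ on the left-handed isospin doublets, by $\lambda$ (up) and $\bar\lambda$ (down) on the right-handed particles, by $\lambda$ on the antileptons and by $m$ on the colors of the antiquarks; intertwining $J$ with the antilinear exchange of particles and antiparticles; and intertwining $\gamma$ with the operator equal to $+1$ on left-handed and $-1$ on right-handed particles and to the opposite sign on the corresponding antiparticles. -/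

import Mathlib

open scoped Quaternion Kronecker Matrix ComplexConjugate

noncomputable section

namespace FiniteGeometry

/-! ## Quaternions as complex `2 × 2` matrices -/

/-- The embedding of the quaternions into `M₂(ℂ)`: writing `q = z + w j` with
`z = re + imI i`, `w = imJ + imK i`, it sends `q` to `[[z, w], [-w̄, z̄]]`. -/
def quatToMatrix : ℍ[ℝ] →⋆ₐ[ℝ] Matrix (Fin 2) (Fin 2) ℂ where
  toFun q := !![⟨q.re, q.imI⟩, ⟨q.imJ, q.imK⟩; ⟨-q.imJ, q.imK⟩, ⟨q.re, -q.imI⟩]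
  map_one' := by
    ext i j; fin_cases i <;> fin_cases j <;> simp [Complex.ext_iff]
  map_zero' := by
    ext i j; fin_cases i <;> fin_cases j <;> simp [Complex.ext_iff]
  map_add' p q := by
    ext i j; fin_cases i <;> fin_cases j <;> simp [Complex.ext_iff, add_comm]
  map_mul' p q := by
    ext i j; fin_cases i <;> fin_cases j <;>
      simp [Complex.ext_iff, Matrix.mul_apply, Fin.sum_univ_two] <;> constructor <;> ring
  commutes' r := by
    ext i j; fin_cases i <;> fin_cases j <;>
      simp [Complex.ext_iff, Matrix.algebraMap_matrix_apply]
  map_star' q := by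
    ext i j; fin_cases i <;> fin_cases j <;>
      simp [Complex.ext_iff, Matrix.star_apply]

/-! ## The algebra and its Hilbert space -/

/-- The algebra `M₂(ℍ) ⊕ M₄(ℂ)`, as a real involutive algebra. -/
abbrev FullAlg : Type := Matrix (Fin 2) (Fin 2) ℍ[ℝ] × Matrix (Fin 4) (Fin 4) ℂ

/-- The algebra `A^ev = ℍ ⊕ ℍ ⊕ M₄(ℂ)`, as a real involutive algebra. -/
abbrev EvenAlg : Type := ℍ[ℝ] × ℍ[ℝ] × Matrix (Fin 4) (Fin 4) ℂ

/-- Index of the standard basis of `V = ℂ⁴`. -/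
abbrev VIdx : Type := Fin 4

/-- Index of the standard complex basis of `W = ℍ² = ℂ² ⊕ ℂ²`: the first entry is the
quaternionic coordinate. -/
abbrev WIdx : Type := Fin 2 × Fin 2

/-- Basis index (matrix units) of `Hom(V, W) ⊕ Hom(W, V)`. -/
abbrev HIdx : Type := (WIdx × VIdx) ⊕ (VIdx × WIdx)

/-- The `32`-dimensional Hilbert space `Hom(V, W) ⊕ Hom(W, V)`, with its Hilbert–Schmidt inner
product: a vector `ξ` is the pair of matrices `x = (ξ (inl (w, v)))`, `y = (ξ (inr (v, w)))`. -/
abbrev HSpace : Type := EuclideanSpace ℂ HIdx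

/-- The embedding `M₂(ℍ) → M₄(ℂ)` given by the action on `W`. -/
def quatMatrixToMatrix : Matrix (Fin 2) (Fin 2) ℍ[ℝ] →⋆ₐ[ℝ] Matrix WIdx WIdx ℂ where
  toAlgHom := (Matrix.compAlgEquiv (Fin 2) (Fin 2) ℂ ℝ).toAlgHom.comp
    quatToMatrix.toAlgHom.mapMatrix
  map_star' a := by
    ext ⟨i, k⟩ ⟨j, l⟩
    have h := congrFun (congrFun (map_star quatToMatrix (a j i)) k) l
    simpa [Matrix.star_apply] using h

/-- The matrix of left multiplication: `(a, b) (x, y) = (a x, b y)`. -/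
def leftMulMatrix : FullAlg →⋆ₐ[ℝ] Matrix HIdx HIdx ℂ where
  toFun a := Matrix.fromBlocks (quatMatrixToMatrix a.1 ⊗ₖ (1 : Matrix VIdx VIdx ℂ)) 0 0
    (a.2 ⊗ₖ (1 : Matrix WIdx WIdx ℂ))
  map_one' := by simp
  map_zero' := by simp
  map_add' a b := by simp [Matrix.add_kronecker, Matrix.fromBlocks_add]
  map_mul' a b := by simp [Matrix.fromBlocks_multiply, ← Matrix.mul_kronecker_mul]
  commutes' r := by
    have h1 : quatMatrixToMatrix ((algebraMap ℝ FullAlg r).1) = algebraMap ℝ _ r :=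
      quatMatrixToMatrix.toAlgHom.commutes r
    have h2 : (algebraMap ℝ FullAlg r).2 = algebraMap ℝ _ r := rfl
    rw [h1, h2]
    simp only [Algebra.algebraMap_eq_smul_one, Matrix.smul_kronecker, Matrix.one_kronecker_one]
    rw [← Matrix.fromBlocks_one, Matrix.fromBlocks_smul]
    simp
  map_star' a := by
    rw [Prod.fst_star, Prod.snd_star, map_star]
    simp only [Matrix.star_eq_conjTranspose, Matrix.fromBlocks_conjTranspose,
      Matrix.conjTranspose_kronecker, Matrix.conjTranspose_zero, Matrix.conjTranspose_one]

/-- The representation of `M₂(ℍ) ⊕ M₄(ℂ)` on the Hilbert space by left multiplication. -/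
def rep : FullAlg →⋆ₐ[ℝ] (HSpace →L[ℂ] HSpace) where
  toFun a := Matrix.toEuclideanCLM (𝕜 := ℂ) (leftMulMatrix a)
  map_one' := by simp
  map_zero' := by simp
  map_add' a b := by simp
  map_mul' a b := by simp
  commutes' r := by
    rw [show leftMulMatrix (algebraMap ℝ FullAlg r) = algebraMap ℝ _ r from
      leftMulMatrix.toAlgHom.commutes r]
    rw [IsScalarTower.algebraMap_apply ℝ ℂ (Matrix HIdx HIdx ℂ),
      IsScalarTower.algebraMap_apply ℝ ℂ (HSpace →L[ℂ] HSpace)]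
    exact (Matrix.toEuclideanCLM (n := HIdx) (𝕜 := ℂ)).toAlgEquiv.commutes _
  map_star' a := by simp [map_star]

/-- The antilinear isometric involution `J (x, y) = (y*, x*)`. -/
def J : HSpace ≃ₗᵢ⋆[ℂ] HSpace where
  toFun ξ := WithLp.toLp 2 (Sum.elim (fun p => conj (ξ (Sum.inr (p.2, p.1))))
    (fun p => conj (ξ (Sum.inl (p.2, p.1)))))
  invFun ξ := WithLp.toLp 2 (Sum.elim (fun p => conj (ξ (Sum.inr (p.2, p.1))))
    (fun p => conj (ξ (Sum.inl (p.2, p.1)))))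
  map_add' ξ η := by ext (p | p) <;> simp
  map_smul' c ξ := by ext (p | p) <;> simp
  left_inv ξ := by ext (p | p) <;> simp
  right_inv ξ := by ext (p | p) <;> simp
  norm_map' ξ := by
    simp only [EuclideanSpace.norm_eq, Fintype.sum_sum_type]
    congr 1
    simp only [LinearEquiv.coe_mk, LinearMap.coe_mk, AddHom.coe_mk, Sum.elim_inl, Sum.elim_inr,
      RCLike.norm_conj]
    rw [add_comm]
    congr 1
    · exact Fintype.sum_equiv (Equiv.prodComm _ _) _ _ (fun _ => rfl)
    · exact Fintype.sum_equiv (Equiv.prodComm _ _) _ _ (fun _ => rfl)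

/-- The `ℤ/2`-grading of `W`: `-1` on the first and `+1` on the second quaternionic line. -/
def gradingW (w : WIdx) : ℂ := if w.1 = 0 then -1 else 1

/-- The `ℤ/2`-grading `γ (x, y) = (Γ x, - y Γ)` where `Γ` is the grading of `W`. -/
def γ : HSpace →L[ℂ] HSpace :=
  Matrix.toEuclideanCLM (𝕜 := ℂ) (Matrix.diagonal
    (Sum.elim (fun p : WIdx × VIdx => gradingW p.1) (fun p : VIdx × WIdx => -gradingW p.2)))

/-- The inclusion `A^ev → M₂(ℍ) ⊕ M₄(ℂ)`, `(p, q, m) ↦ (diag (p, q), m)`. -/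
def evenIncl : EvenAlg →⋆ₐ[ℝ] FullAlg where
  toFun a := (Matrix.diagonal ![a.1, a.2.1], a.2.2)
  map_one' := by
    refine Prod.ext ?_ rfl
    ext i j : 1; fin_cases i <;> fin_cases j <;> simp
  map_zero' := by
    refine Prod.ext ?_ rfl
    ext i j : 1; fin_cases i <;> fin_cases j <;> simp
  map_add' a b := by
    refine Prod.ext ?_ rfl
    ext i j : 1; fin_cases i <;> fin_cases j <;> simp
  map_mul' a b := by
    refine Prod.ext ?_ rfl
    ext i j : 1; fin_cases i <;> fin_cases j <;> simp
  commutes' r := by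
    refine Prod.ext ?_ rfl
    ext i j : 1; fin_cases i <;> fin_cases j <;> simp [Matrix.algebraMap_matrix_apply]
  map_star' a := by
    refine Prod.ext ?_ rfl
    ext i j : 1; fin_cases i <;> fin_cases j <;> simp [Matrix.star_apply]

/-- `A^ev` is the even part of `M₂(ℍ) ⊕ M₄(ℂ)`: the elements whose action commutes with `γ`. -/
theorem mem_range_evenIncl (a : FullAlg) :
    (∃ b, evenIncl b = a) ↔ rep a * γ = γ * rep a := by
  have entry : ∀ w w' : WIdx, quatMatrixToMatrix a.1 w w' = quatToMatrix (a.1 w.1 w'.1) w.2 w'.2 :=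
    fun _ _ => rfl
  have key : rep a * γ = γ * rep a ↔
      ∀ w w' : WIdx, quatToMatrix (a.1 w.1 w'.1) w.2 w'.2 * gradingW w' =
        gradingW w * quatToMatrix (a.1 w.1 w'.1) w.2 w'.2 := by
    change Matrix.toEuclideanCLM (𝕜 := ℂ) (leftMulMatrix a) * γ =
      γ * Matrix.toEuclideanCLM (𝕜 := ℂ) (leftMulMatrix a) ↔ _
    rw [γ, ← map_mul, ← map_mul, EmbeddingLike.apply_eq_iff_eq, ← Matrix.ext_iff]
    simp only [Matrix.mul_diagonal, Matrix.diagonal_mul]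
    constructor
    · intro h w w'
      simpa [leftMulMatrix, entry] using h (Sum.inl (w, 0)) (Sum.inl (w', 0))
    · rintro h (⟨w, v⟩ | ⟨v, w⟩) (⟨w', v'⟩ | ⟨v', w'⟩)
      · have := h w w'
        simp only [leftMulMatrix, StarAlgHom.coe_mk', AlgHom.coe_mk, RingHom.coe_mk,
          MonoidHom.coe_mk, OneHom.coe_mk, Matrix.fromBlocks_apply₁₁, Matrix.kroneckerMap_apply,
          Sum.elim_inl, entry]
        linear_combination (1 : Matrix VIdx VIdx ℂ) v v' * this
      · simp [leftMulMatrix]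
      · simp [leftMulMatrix]
      · by_cases hw : w = w'
        · simp [leftMulMatrix, hw, mul_comm]
        · simp [leftMulMatrix, Matrix.one_apply_ne hw]
  have inj : ∀ q : ℍ[ℝ], (∀ k l, quatToMatrix q k l = 0) → q = 0 := by
    intro q h
    have h0 := h 0 0
    have h1 := h 0 1
    simp only [quatToMatrix, StarAlgHom.coe_mk', AlgHom.coe_mk, RingHom.coe_mk,
      MonoidHom.coe_mk, OneHom.coe_mk, Complex.ext_iff] at h0 h1
    simp at h0 h1
    ext <;> simp [h0, h1]
  rw [key]
  constructor
  · rintro ⟨b, rfl⟩ ⟨s, k⟩ ⟨t, l⟩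
    fin_cases s <;> fin_cases t <;> simp [evenIncl, gradingW]
  · intro h
    refine ⟨(a.1 0 0, a.1 1 1, a.2), Prod.ext ?_ rfl⟩
    have h01 : a.1 0 1 = 0 := inj _ fun k l => by
      have := h (0, k) (1, l)
      simp [gradingW] at this
      linear_combination this / 2
    have h10 : a.1 1 0 = 0 := inj _ fun k l => by
      have := h (1, k) (0, l)
      simp [gradingW] at this
      linear_combination -this / 2
    ext i j : 1
    fin_cases i <;> fin_cases j <;> simp [evenIncl, h01, h10]

/-- The representation of `A^ev` on the Hilbert space. -/
def repEv : EvenAlg →⋆ₐ[ℝ] (HSpace →L[ℂ] HSpace) := rep.comp evenIncl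

/-! ## Dirac operators -/

/-- For an operator `T`, the operator `T⁰ = J T* J⁻¹`. -/
def opp (T : HSpace →L[ℂ] HSpace) : HSpace →L[ℂ] HSpace :=
  (J.toContinuousLinearEquiv : HSpace →L⋆[ℂ] HSpace).comp
    ((star T).comp (J.symm.toContinuousLinearEquiv : HSpace →L⋆[ℂ] HSpace))

/-- Dirac operators of the even real geometry of KO-dimension `6`: self-adjoint operators that
commute with `J` and anticommute with `γ`. -/
structure IsDirac (D : HSpace →L[ℂ] HSpace) : Prop where
  selfAdjoint : IsSelfAdjoint D
  comm_J : ∀ ξ, D (J ξ) = J (D ξ)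
  anticomm_γ : D * γ = -(γ * D)

/-- The order one condition `[[D, a], b⁰] = 0` for all `a, b` in `B`. -/
def OrderOne (B : NonUnitalStarSubalgebra ℝ EvenAlg) (D : HSpace →L[ℂ] HSpace) : Prop :=
  ∀ a ∈ B, ∀ b ∈ B, ⁅⁅D, repEv a⁆, opp (repEv b)⁆ = 0

/-- The operator `D` is off-diagonal: `[D, Z(A)] ≠ {0}`, with `Z(A)` the center of
`A = M₂(ℍ) ⊕ M₄(ℂ)`. -/
def OffDiagonal (D : HSpace →L[ℂ] HSpace) : Prop :=
  ∃ z ∈ Subalgebra.center ℝ FullAlg, ⁅D, rep z⁆ ≠ 0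

/-- The involutive subalgebra `B` of `A^ev` admits off-diagonal Dirac operators. -/
def AdmitsOffDiagonal (B : NonUnitalStarSubalgebra ℝ EvenAlg) : Prop :=
  ∃ D : HSpace →L[ℂ] HSpace, IsDirac D ∧ OrderOne B D ∧ OffDiagonal D

/-- `B` has maximal dimension among the involutive subalgebras of `A^ev` that admit off-diagonal
Dirac operators. -/
def IsMaximalAdmissible (B : NonUnitalStarSubalgebra ℝ EvenAlg) : Prop :=
  AdmitsOffDiagonal B ∧
    ∀ C : NonUnitalStarSubalgebra ℝ EvenAlg, AdmitsOffDiagonal C →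
      Module.finrank ℝ C ≤ Module.finrank ℝ B

/-! ## The Standard Model algebra and its one-generation geometry -/

/-- The algebra `ℂ ⊕ ℍ ⊕ M₃(ℂ)`, as a real involutive algebra. -/
abbrev SMAlg : Type := ℂ × ℍ[ℝ] × Matrix (Fin 3) (Fin 3) ℂ

/-- The block matrix `l ⊕ m` in `M₄(ℂ)`. -/
def oplus (l : ℂ) (m : Matrix (Fin 3) (Fin 3) ℂ) : Matrix (Fin 4) (Fin 4) ℂ :=
  Matrix.reindexAlgEquiv ℂ ℂ (finSumFinEquiv : Fin 1 ⊕ Fin 3 ≃ Fin 4)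
    (Matrix.fromBlocks (Matrix.diagonal fun _ => l) 0 0 m)

/-- The map `(l, q, m) ↦ (l ⊕ q, l ⊕ m)` from `ℂ ⊕ ℍ ⊕ M₃(ℂ)` to `ℍ ⊕ ℍ ⊕ M₄(ℂ)`, where `ℂ` is
embedded in `ℍ` by `x + y i ↦ x + y i`. -/
def smIncl : SMAlg →⋆ₐ[ℝ] EvenAlg where
  toFun a := (Quaternion.ofComplex a.1, a.2.1, oplus a.1 a.2.2)
  map_one' := by simp [oplus]
  map_zero' := by simp [oplus]
  map_add' a b := by
    rw [Prod.fst_add, Prod.snd_add, map_add]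
    simp only [Prod.fst_add, Prod.snd_add, Prod.mk_add_mk, oplus, ← map_add,
      Matrix.fromBlocks_add, Matrix.diagonal_add, add_zero]
  map_mul' a b := by
    rw [Prod.fst_mul, Prod.snd_mul, map_mul]
    simp only [Prod.fst_mul, Prod.snd_mul, Prod.mk_mul_mk, oplus, ← map_mul,
      Matrix.fromBlocks_multiply, Matrix.diagonal_mul_diagonal, Matrix.mul_zero, Matrix.zero_mul,
      add_zero, zero_add]
  commutes' r := by
    refine Prod.ext ?_ (Prod.ext rfl ?_)
    · exact Quaternion.ofComplex.commutes r
    · ext i j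
      fin_cases i <;> fin_cases j <;>
        simp [oplus, Matrix.algebraMap_matrix_apply, finSumFinEquiv, Fin.addCases]
  map_star' a := by
    refine Prod.ext ?_ (Prod.ext rfl ?_)
    · ext <;> simp
    · simp only [oplus, Matrix.coe_reindexAlgEquiv, Matrix.star_eq_conjTranspose, Prod.snd_star,
        Prod.fst_star, Matrix.conjTranspose_reindex, Matrix.fromBlocks_conjTranspose,
        Matrix.diagonal_conjTranspose, Matrix.conjTranspose_zero]
      rfl

instance : StarModule ℝ EvenAlg where
  star_smul r a := by
    refine Prod.ext ?_ (Prod.ext ?_ ?_)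
    · ext <;> simp
    · ext <;> simp
    · ext i j <;> simp [Matrix.star_apply]

/-- The involutive subalgebra `{(l ⊕ q, l ⊕ m)} ⊆ ℍ ⊕ ℍ ⊕ M₄(ℂ)`. -/
def AF : StarSubalgebra ℝ EvenAlg := smIncl.range

/-- Chirality. -/
inductive Chirality
  | left
  | right
  deriving DecidableEq

instance : Fintype Chirality := ⟨{.left, .right}, by rintro (_ | _); all_goals simp⟩

/-- Weak isospin. -/
inductive Isospin
  | up
  | down
  deriving DecidableEq

instance : Fintype Isospin := ⟨{.up, .down}, by rintro (_ | _); all_goals simp⟩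

/-- Leptons, and quarks with their color. -/
inductive Flavor
  | lepton
  | quark (color : Fin 3)
  deriving DecidableEq, Fintype

/-- The basis of the `32`-dimensional space of one generation: the `16` fermions and their `16`
antiparticles, each labelled by the chirality, isospin and flavor of the particle. -/
inductive Fermion
  | particle (χ : Chirality) (i : Isospin) (f : Flavor)
  | anti (χ : Chirality) (i : Isospin) (f : Flavor)
  deriving DecidableEq, Fintype

/-- The Hilbert space of one generation of fermions. -/
abbrev SMSpace : Type := EuclideanSpace ℂ Fermion

/-- The numbering of isospin. -/
def Isospin.toFin : Isospin → Fin 2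
  | up => 0
  | down => 1

open Chirality Isospin Flavor Fermion in
/-- The action of `(l, q, m)` on one generation of fermions: `q` acts on the left-handed doublets,
`diag (l, l̄)` on the right-handed singlets, `l` on the antileptons, `m` on the antiquarks. -/
def smAction (a : SMAlg) (ξ : SMSpace) : SMSpace :=
  WithLp.toLp 2 fun
    | particle left i f => ∑ k, quatToMatrix a.2.1 i.toFin (Isospin.toFin k) *
        ξ (particle left k f)
    | particle right up f => a.1 * ξ (particle right up f)
    | particle right down f => conj a.1 * ξ (particle right down f)
    | anti χ i lepton => a.1 * ξ (anti χ i lepton)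
    | anti χ i (quark c) => ∑ d, a.2.2 c d * ξ (anti χ i (quark d))

/-- The real structure on one generation: the antilinear exchange of particles and
antiparticles. -/
def smJ (ξ : SMSpace) : SMSpace :=
  WithLp.toLp 2 fun
    | .particle χ i f => conj (ξ (.anti χ i f))
    | .anti χ i f => conj (ξ (.particle χ i f))

/-- The sign `+1` for left-handed and `-1` for right-handed particles. -/
def Chirality.sign : Chirality → ℂ
  | left => 1
  | right => -1

/-- The grading on one generation: the chirality of particles, and its opposite on
antiparticles. -/
def smγ (ξ : SMSpace) : SMSpace :=
  WithLp.toLp 2 fun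
    | .particle χ i f => χ.sign * ξ (.particle χ i f)
    | .anti χ i f => -χ.sign * ξ (.anti χ i f)

end FiniteGeometry

end

/-!
An off-diagonal Dirac operator for a subalgebra `B` amounts to a nonzero intertwiner, and the theorem
is then a matter of stabilizers.

Write `D` in blocks for `Hom(V, W) ⊕ Hom(W, V)`, with lower left block `T`. Since the center of
`M₂(ℍ) ⊕ M₄(ℂ)` is `ℝ ⊕ ℂ` and `D` is self-adjoint, `D` is off-diagonal only if `T ≠ 0`. The
operator `b⁰` is right multiplication, so for `a = (p, q, m)` and `b = (p', q', m')` the lower left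
block of the order one condition says that `C = T (p ⊕ q) - m T` satisfies
`(C (x)) (p' ⊕ q') = C (x m')`. If `C ≠ 0` for some `a ∈ B`, a slice of the tensor `C` is a nonzero
`A : W → V` with `A (p' ⊕ q') = m' A` for all of `B`; if `C = 0` for every `a ∈ B`, a slice of `T`
is such an `A`. Restricting to one of the two quaternionic lines of `W` gives a nonzero `4 × 2`
matrix `A` with `A p = m A` on `B`, or `A q = m A` on `B` (`exists_intertwiner`). As the two lines
are exchanged by an automorphism of `A^ev`, only the first case matters.

If `A` is injective, then `m` respects the decomposition of `V` into the range of `A` and its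
orthogonal complement and is determined by `p` on the former, so `B` embeds into `ℍ ⊕ ℍ ⊕ M₂(ℂ)`
and has dimension at most `16` (`finrank_le_of_injective_intertwiner`). Otherwise the kernel of `A`
and the range of `A` are lines, preserved by `p` and `m`. Unit quaternions act transitively on the
lines of `ℂ²` and unitaries on those of `V`, so after an inner automorphism `p = diag (l, l̄)` and
`m = l ⊕ m''`, which means that `B` is carried into `A_F`
(`exists_automorphism_of_intertwiner`). As `A_F` has dimension `24` and commutes with the
off-diagonal Dirac operator that exchanges two suitable basis vectors, it is maximal, and every
maximal `B` is carried onto it.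

The identification with one generation of fermions is a relabelling of the orthonormal basis of
matrix units (`fermionEquiv`).
-/

noncomputable section

namespace FiniteGeometry

/-! ### From Dirac operators to intertwiners -/

theorem quatMatrixToMatrix_apply (a : Matrix (Fin 2) (Fin 2) ℍ[ℝ]) (w w' : WIdx) :
    quatMatrixToMatrix a w w' = quatToMatrix (a w.1 w'.1) w.2 w'.2 := rfl

theorem J_apply_inl (ξ : HSpace) (w : WIdx) (v : VIdx) :
    J ξ (Sum.inl (w, v)) = conj (ξ (Sum.inr (v, w))) := rfl

theorem J_apply_inr (ξ : HSpace) (v : VIdx) (w : WIdx) :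
    J ξ (Sum.inr (v, w)) = conj (ξ (Sum.inl (w, v))) := rfl

theorem J_symm : J.symm = J := rfl

/-- The matrix of `b⁰`: right multiplication `(x, y) ↦ (x n, y b)`. -/
theorem opp_rep (b : FullAlg) :
    opp (rep b) = Matrix.toEuclideanCLM (𝕜 := ℂ) (Matrix.fromBlocks
      ((1 : Matrix WIdx WIdx ℂ) ⊗ₖ b.2ᵀ) 0 0
      ((1 : Matrix VIdx VIdx ℂ) ⊗ₖ (quatMatrixToMatrix b.1)ᵀ)) := by
  have h : star (rep b) = Matrix.toEuclideanCLM (𝕜 := ℂ) (leftMulMatrix (star b)) :=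
    (map_star rep b).symm
  ext ξ i
  rw [opp, h, map_star, J_symm]
  change J (Matrix.toEuclideanCLM (𝕜 := ℂ) (star (leftMulMatrix b)) (J ξ)) i = _
  rcases i with ⟨w, v⟩ | ⟨v, w⟩
  · rw [J_apply_inl]
    simp [leftMulMatrix, Matrix.mulVec, dotProduct,
      Fintype.sum_sum_type, Matrix.star_apply, Matrix.one_apply]
    simp only [Fintype.sum_prod_type (α₁ := VIdx), Fintype.sum_prod_type (α₁ := WIdx)]
    simp
    refine Finset.sum_congr rfl fun x _ => ?_
    rw [J_apply_inr, Complex.conj_conj]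
  · rw [J_apply_inr]
    simp [leftMulMatrix, Matrix.mulVec, dotProduct,
      Fintype.sum_sum_type, Matrix.star_apply, Matrix.one_apply]
    simp only [Fintype.sum_prod_type (α₁ := VIdx), Fintype.sum_prod_type (α₁ := WIdx)]
    simp
    refine Finset.sum_congr rfl fun x _ => ?_
    rw [J_apply_inl, Complex.conj_conj]

/-- The center of `M₂(ℍ) ⊕ M₄(ℂ)` is `ℝ ⊕ ℂ`, so it acts by a scalar on each of the two blocks. -/
theorem rep_eq_of_mem_center {z : FullAlg} (hz : z ∈ Subalgebra.center ℝ FullAlg) :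
    ∃ c d : ℂ, rep z = Matrix.toEuclideanCLM (𝕜 := ℂ)
      (Matrix.fromBlocks (c • 1) 0 0 (d • 1)) := by
  rw [Subalgebra.mem_center_iff] at hz
  have h1 : z.1 ∈ Set.center (Matrix (Fin 2) (Fin 2) ℍ[ℝ]) := by
    rw [Semigroup.mem_center_iff]
    exact fun g => congrArg Prod.fst (hz (g, 0))
  have h2 : z.2 ∈ Set.center (Matrix (Fin 4) (Fin 4) ℂ) := by
    rw [Semigroup.mem_center_iff]
    exact fun g => congrArg Prod.snd (hz (0, g))
  rw [Matrix.center_eq_scalar_image] at h1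
  rw [Matrix.center_eq_range] at h2
  obtain ⟨q, hq, hq'⟩ := h1
  obtain ⟨d, hd⟩ := h2
  rw [Semigroup.mem_center_iff] at hq
  have hI (g : ℍ[ℝ]) := congrArg QuaternionAlgebra.imI (hq g)
  have hJ (g : ℍ[ℝ]) := congrArg QuaternionAlgebra.imJ (hq g)
  have hK (g : ℍ[ℝ]) := congrArg QuaternionAlgebra.imK (hq g)
  simp only [Quaternion.imI_mul, Quaternion.imJ_mul, Quaternion.imK_mul] at hI hJ hK
  have e1 : q.imI = 0 := by linarith [hK ⟨0, 0, 1, 0⟩]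
  have e2 : q.imJ = 0 := by linarith [hK ⟨0, 1, 0, 0⟩]
  have e3 : q.imK = 0 := by linarith [hJ ⟨0, 1, 0, 0⟩]
  refine ⟨q.re, d, ?_⟩
  change Matrix.toEuclideanCLM (𝕜 := ℂ) (Matrix.fromBlocks
    (quatMatrixToMatrix z.1 ⊗ₖ (1 : Matrix VIdx VIdx ℂ)) 0 0
    (z.2 ⊗ₖ (1 : Matrix WIdx WIdx ℂ))) = _
  have k1 : quatMatrixToMatrix z.1 = (q.re : ℂ) • 1 := by
    ext ⟨s, k⟩ ⟨t, l⟩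
    rw [quatMatrixToMatrix_apply, ← hq']
    fin_cases s <;> fin_cases t <;> fin_cases k <;> fin_cases l <;>
      simp [quatToMatrix, e1, e2, e3, Complex.ext_iff]
  have k2 : z.2 = d • 1 := by rw [← hd, Matrix.smul_one_eq_diagonal]; rfl
  rw [k1, k2, Matrix.smul_kronecker, Matrix.smul_kronecker, Matrix.one_kronecker_one,
    Matrix.one_kronecker_one]

/-- An off-diagonal Dirac operator provides a nonzero map `W → V` which intertwines the action of
`B`: a slice of the off-diagonal block `T` of `D`, or of a commutator `T (p ⊕ q) - m T`. -/
theorem exists_intertwiner_sum {B : NonUnitalStarSubalgebra ℝ EvenAlg}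
    (hB : AdmitsOffDiagonal B) :
    ∃ A : Matrix VIdx WIdx ℂ, A ≠ 0 ∧
      ∀ b ∈ B, A * quatMatrixToMatrix (evenIncl b).1 = (evenIncl b).2 * A := by
  obtain ⟨D, hD, hO, z, hz, hne⟩ := hB
  obtain ⟨M, rfl⟩ : ∃ M, Matrix.toEuclideanCLM (n := HIdx) (𝕜 := ℂ) M = D :=
    (Matrix.toEuclideanCLM (n := HIdx) (𝕜 := ℂ)).surjective D
  have hsa : star M = M := by
    have := hD.selfAdjoint.star_eq
    rwa [← map_star, EmbeddingLike.apply_eq_iff_eq] at this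
  obtain ⟨S, R, T, S', rfl⟩ : ∃ S R T S', M = Matrix.fromBlocks S R T S' :=
    ⟨_, _, _, _, (Matrix.fromBlocks_toBlocks M).symm⟩
  have hT : T ≠ 0 := by
    rintro rfl
    rw [Matrix.star_eq_conjTranspose, Matrix.fromBlocks_conjTranspose,
      Matrix.fromBlocks_inj] at hsa
    obtain ⟨-, hR, -, -⟩ := hsa
    rw [Matrix.conjTranspose_zero] at hR
    subst hR
    obtain ⟨c, d, hcd⟩ := rep_eq_of_mem_center hz
    apply hne
    rw [hcd, Ring.lie_def, ← map_mul, ← map_mul, Matrix.fromBlocks_multiply,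
      Matrix.fromBlocks_multiply]
    simp
  -- the lower left block of the order one condition
  have key : ∀ a ∈ B, ∀ b ∈ B,
      (T * (quatMatrixToMatrix (evenIncl a).1 ⊗ₖ (1 : Matrix VIdx VIdx ℂ)) -
        ((evenIncl a).2 ⊗ₖ (1 : Matrix WIdx WIdx ℂ)) * T) *
          ((1 : Matrix WIdx WIdx ℂ) ⊗ₖ (evenIncl b).2ᵀ) =
      ((1 : Matrix VIdx VIdx ℂ) ⊗ₖ (quatMatrixToMatrix (evenIncl b).1)ᵀ) *
      (T * (quatMatrixToMatrix (evenIncl a).1 ⊗ₖ (1 : Matrix VIdx VIdx ℂ)) -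
        ((evenIncl a).2 ⊗ₖ (1 : Matrix WIdx WIdx ℂ)) * T) := by
    intro a ha b hb
    have h := hO a ha b hb
    have e1 : repEv a = Matrix.toEuclideanCLM (𝕜 := ℂ) (Matrix.fromBlocks
      (quatMatrixToMatrix (evenIncl a).1 ⊗ₖ (1 : Matrix VIdx VIdx ℂ)) 0 0
      ((evenIncl a).2 ⊗ₖ (1 : Matrix WIdx WIdx ℂ))) := rfl
    have e2 : opp (repEv b) = _ := opp_rep (evenIncl b)
    rw [e1, e2, Ring.lie_def, Ring.lie_def, sub_eq_zero] at h
    rw [← map_mul, ← map_mul, ← map_sub, ← map_mul, ← map_mul,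
      EmbeddingLike.apply_eq_iff_eq] at h
    have h' := congrArg Matrix.toBlocks₂₁ h
    simp only [Matrix.fromBlocks_multiply, sub_eq_add_neg, Matrix.fromBlocks_neg,
      Matrix.fromBlocks_add, Matrix.toBlocks_fromBlocks₂₁] at h'
    simpa [sub_eq_add_neg] using h'
  by_cases hC : ∃ a ∈ B, T * (quatMatrixToMatrix (evenIncl a).1 ⊗ₖ (1 : Matrix VIdx VIdx ℂ)) -
        ((evenIncl a).2 ⊗ₖ (1 : Matrix WIdx WIdx ℂ)) * T ≠ 0
  · obtain ⟨a, ha, hne⟩ := hC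
    have key' := key a ha
    generalize T * (quatMatrixToMatrix (evenIncl a).1 ⊗ₖ (1 : Matrix VIdx VIdx ℂ)) -
        ((evenIncl a).2 ⊗ₖ (1 : Matrix WIdx WIdx ℂ)) * T = C at hne key'
    obtain ⟨⟨v, w⟩, ⟨w', v'⟩, hC⟩ : ∃ i j, C i j ≠ 0 := by
      by_contra! h
      exact hne (Matrix.ext h)
    -- `C` is a sum of maps `x ↦ A₁ x A₂`; fixing `v` and `w'` contracts the factor `A₁`
    refine ⟨Matrix.of fun u x => C (v, x) (w', u), fun h => hC (congrFun₂ h v' w), ?_⟩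
    intro b hb
    ext u x
    have := congrFun₂ (key' b hb) (v, x) (w', u)
    simp [Matrix.mul_apply, Fintype.sum_prod_type, Matrix.one_apply] at this ⊢
    simpa [mul_comm] using this.symm
  · push Not at hC
    obtain ⟨⟨v, w⟩, ⟨w', v'⟩, hT⟩ : ∃ i j, T i j ≠ 0 := by
      by_contra! h
      exact hT (Matrix.ext h)
    -- here the factor `A₂` of `T` is contracted
    refine ⟨Matrix.of fun u x => T (u, w) (x, v'), fun h => hT (congrFun₂ h v w'), ?_⟩
    intro b hb
    ext u x
    have := congrFun₂ (sub_eq_zero.1 (hC b hb)) (u, w) (x, v')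
    simpa [Matrix.mul_apply, Fintype.sum_prod_type, Matrix.one_apply] using this

/-- The intertwiner of `exists_intertwiner_sum`, restricted to a quaternionic line of `W` on which it
does not vanish. -/
theorem exists_intertwiner {B : NonUnitalStarSubalgebra ℝ EvenAlg}
    (hB : AdmitsOffDiagonal B) :
    ∃ A : Matrix (Fin 4) (Fin 2) ℂ, A ≠ 0 ∧
      ((∀ b ∈ B, A * quatToMatrix b.1 = b.2.2 * A) ∨
        ∀ b ∈ B, A * quatToMatrix b.2.1 = b.2.2 * A) := by
  obtain ⟨A, hA, h⟩ := exists_intertwiner_sum hB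
  have h0 : ∀ b ∈ B, (A.submatrix id (Prod.mk 0)) * quatToMatrix b.1 =
      b.2.2 * A.submatrix id (Prod.mk 0) := by
    intro b hb
    ext v k
    have := congrFun₂ (h b hb) v (0, k)
    simpa [Matrix.mul_apply, Fintype.sum_prod_type, quatMatrixToMatrix_apply, evenIncl] using this
  have h1 : ∀ b ∈ B, (A.submatrix id (Prod.mk 1)) * quatToMatrix b.2.1 =
      b.2.2 * A.submatrix id (Prod.mk 1) := by
    intro b hb
    ext v k
    have := congrFun₂ (h b hb) v (1, k)
    simpa [Matrix.mul_apply, Fintype.sum_prod_type, quatMatrixToMatrix_apply, evenIncl] using this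
  by_cases hz : A.submatrix id (Prod.mk 0) = 0
  · refine ⟨_, fun hz' => hA ?_, Or.inr h1⟩
    ext v ⟨s, k⟩
    fin_cases s
    · exact congrFun₂ hz v k
    · exact congrFun₂ hz' v k
  · exact ⟨_, hz, Or.inl h0⟩

/-! ### The subalgebra `A_F` -/

theorem oplus_apply_zero (l : ℂ) (m : Matrix (Fin 3) (Fin 3) ℂ) (j : Fin 4) :
    oplus l m 0 j = if j = 0 then l else 0 := by
  fin_cases j <;> simp [oplus, finSumFinEquiv, Fin.addCases]

theorem oplus_apply_succ_zero (l : ℂ) (m : Matrix (Fin 3) (Fin 3) ℂ) (i : Fin 3) :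
    oplus l m i.succ 0 = 0 := by
  fin_cases i <;> simp [oplus, finSumFinEquiv, Fin.addCases]

theorem oplus_apply_succ_succ (l : ℂ) (m : Matrix (Fin 3) (Fin 3) ℂ) (i j : Fin 3) :
    oplus l m i.succ j.succ = m i j := by
  fin_cases i <;> fin_cases j <;> simp [oplus, finSumFinEquiv, Fin.addCases]

theorem smIncl_injective : Function.Injective smIncl := by
  rintro ⟨l, q, m⟩ ⟨l', q', m'⟩ h
  have h1 : oplus l m = oplus l' m' := congrArg (fun x : EvenAlg => x.2.2) h
  have h2 : q = q' := congrArg (fun x : EvenAlg => x.2.1) h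
  refine Prod.ext ?_ (Prod.ext h2 ?_)
  · simpa [oplus_apply_zero] using congrFun₂ h1 0 0
  · ext i j
    simpa [oplus_apply_succ_succ] using congrFun₂ h1 i.succ j.succ

theorem finrank_AF : Module.finrank ℝ AF.toNonUnitalStarSubalgebra = 24 := by
  have e := (StarAlgEquiv.ofInjective smIncl smIncl_injective).toAlgEquiv.toLinearEquiv.finrank_eq
  have : Module.finrank ℝ SMAlg = 24 := by
    simp only [Module.finrank_prod, Quaternion.finrank_eq_four, Complex.finrank_real_complex,
      Module.finrank_matrix, Fintype.card_fin]
  rw [this] at e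
  exact e.symm

/-! ### An off-diagonal Dirac operator for `A_F` -/

theorem single_one_mul_of_row {n : Type*} [Fintype n] [DecidableEq n] (i : n) {j : n}
    {L : Matrix n n ℂ} {l : ℂ} (h : ∀ k, L j k = if j = k then l else 0) :
    Matrix.single i j 1 * L = Matrix.single i j l := by
  ext a b
  by_cases ha : i = a
  · subst ha; simp [h, Matrix.single_apply]
  · simp [Matrix.mul_apply, ha]

theorem mul_single_one_of_col {n : Type*} [Fintype n] [DecidableEq n] {i : n} (j : n)
    {L : Matrix n n ℂ} {l : ℂ} (h : ∀ k, L k i = if i = k then l else 0) :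
    L * Matrix.single i j 1 = Matrix.single i j l := by
  ext a b
  by_cases ha : j = b
  · subst ha; simp [h, Matrix.single_apply]
  · simp [Matrix.mul_apply, ha]

/-- The operator that exchanges the matrix unit `W ← V` at `(0, 0), 0` with its adjoint `V ← W` and
kills all the other matrix units. With `A` the latter matrix unit its off-diagonal block is
`x ↦ A x A`. -/
def swapDirac : HSpace →L[ℂ] HSpace :=
  Matrix.toEuclideanCLM (𝕜 := ℂ)
    (Matrix.single (Sum.inl ((0, 0), 0)) (Sum.inr (0, (0, 0))) 1 +
      Matrix.single (Sum.inr (0, (0, 0))) (Sum.inl ((0, 0), 0)) 1)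

theorem isDirac_swapDirac : IsDirac swapDirac where
  selfAdjoint := by
    rw [IsSelfAdjoint, swapDirac, ← map_star, Matrix.star_eq_conjTranspose,
      Matrix.conjTranspose_add, Matrix.conjTranspose_single, Matrix.conjTranspose_single, add_comm]
    simp
  comm_J ξ := by
    ext i
    rcases i with ⟨⟨s, k⟩, v⟩ | ⟨v, ⟨s, k⟩⟩
    · simp [swapDirac, J, Matrix.single_mulVec, Function.update_apply,
        apply_ite (starRingEnd ℂ), and_comm]
    · simp [swapDirac, J, Matrix.single_mulVec, Function.update_apply,
        apply_ite (starRingEnd ℂ), and_comm]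
  anticomm_γ := by
    rw [swapDirac, γ, ← map_mul, ← map_mul, ← map_neg, EmbeddingLike.apply_eq_iff_eq]
    have hd : ∀ (d : HIdx → ℂ) (i k : HIdx), Matrix.diagonal d i k = if i = k then d i else 0 :=
      fun _ _ _ => rfl
    have hd' : ∀ (d : HIdx → ℂ) (i k : HIdx), Matrix.diagonal d k i = if i = k then d i else 0 :=
      fun d i k => by
        rw [← Matrix.diagonal_transpose]
        rfl
    rw [add_mul, mul_add, single_one_mul_of_row _ (hd _ _), single_one_mul_of_row _ (hd _ _),
      mul_single_one_of_col _ (hd' _ _), mul_single_one_of_col _ (hd' _ _), neg_add]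
    simp [gradingW, Matrix.single_neg]

theorem lie_swapDirac_repEv (a : SMAlg) : ⁅swapDirac, repEv (smIncl a)⁆ = 0 := by
  have e1 : repEv (smIncl a) =
    Matrix.toEuclideanCLM (𝕜 := ℂ) (leftMulMatrix (evenIncl (smIncl a))) := rfl
  rw [e1, swapDirac, Ring.lie_def, ← map_mul, ← map_mul, sub_eq_zero, EmbeddingLike.apply_eq_iff_eq]
  -- both basis vectors exchanged by `D` are eigenvectors of `a` and `a*`, for `l` and `l̄`
  have r1 : ∀ k, leftMulMatrix (evenIncl (smIncl a)) (Sum.inl ((0, 0), 0)) k =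
      if Sum.inl ((0, 0), 0) = k then a.1 else 0 := by
    rintro (⟨⟨s, k⟩, v⟩ | ⟨v, w⟩)
    · fin_cases s <;> fin_cases k <;>
        simp [leftMulMatrix, evenIncl, smIncl, quatMatrixToMatrix_apply, quatToMatrix,
          Matrix.one_apply, Complex.ext_iff]
    · simp [leftMulMatrix]
  have r2 : ∀ k, leftMulMatrix (evenIncl (smIncl a)) k (Sum.inl ((0, 0), 0)) =
      if Sum.inl ((0, 0), 0) = k then a.1 else 0 := by
    rintro (⟨⟨s, k⟩, v⟩ | ⟨v, w⟩)
    · fin_cases s <;> fin_cases k <;>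
        simp [leftMulMatrix, evenIncl, smIncl, quatMatrixToMatrix_apply, quatToMatrix,
          Matrix.one_apply, Complex.ext_iff, eq_comm]
    · simp [leftMulMatrix]
  have r3 : ∀ k, leftMulMatrix (evenIncl (smIncl a)) (Sum.inr (0, (0, 0))) k =
      if Sum.inr (0, (0, 0)) = k then a.1 else 0 := by
    rintro (⟨w, v⟩ | ⟨v, w⟩)
    · simp [leftMulMatrix]
    · simp [leftMulMatrix, evenIncl, smIncl, oplus_apply_zero, Matrix.one_apply, ← ite_and, eq_comm,
        and_comm]
  have r4 : ∀ k, leftMulMatrix (evenIncl (smIncl a)) k (Sum.inr (0, (0, 0))) =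
      if Sum.inr (0, (0, 0)) = k then a.1 else 0 := by
    rintro (⟨w, v⟩ | ⟨v, w⟩)
    · simp [leftMulMatrix]
    · cases v using Fin.cases <;> simp [leftMulMatrix, evenIncl, smIncl, oplus_apply_zero,
        oplus_apply_succ_zero, Matrix.one_apply, eq_comm]
  rw [add_mul, mul_add, single_one_mul_of_row _ r3, single_one_mul_of_row _ r1,
    mul_single_one_of_col _ r2, mul_single_one_of_col _ r4]

theorem admitsOffDiagonal_AF : AdmitsOffDiagonal AF.toNonUnitalStarSubalgebra := by
  refine ⟨swapDirac, isDirac_swapDirac, ?_, (1, 0), ?_, ?_⟩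
  · rintro _ ⟨a, rfl⟩ b -
    change ⁅⁅swapDirac, repEv (smIncl a)⁆, _⁆ = 0
    rw [lie_swapDirac_repEv, Ring.lie_def, zero_mul, mul_zero, sub_zero]
  · rw [Subalgebra.mem_center_iff]
    intro b
    ext : 1 <;> simp
  · intro h
    have e1 : rep (1, 0) = Matrix.toEuclideanCLM (𝕜 := ℂ) (leftMulMatrix (1, 0)) := rfl
    rw [e1, swapDirac, Ring.lie_def, ← map_mul, ← map_mul, sub_eq_zero,
      EmbeddingLike.apply_eq_iff_eq] at h
    have := congrFun₂ h (Sum.inr (0, (0, 0))) (Sum.inl ((0, 0), 0))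
    simp [leftMulMatrix, Matrix.mul_apply, Matrix.add_apply, Matrix.single_apply] at this

/-! ### Consequences of an intertwiner -/

/-- Unitaries act transitively on lines: every nonzero vector is proportional to the `i`-th column of
a unitary matrix. -/
theorem exists_unitary_col {n : Type*} [Fintype n] [DecidableEq n] (i : n) {f : n → ℂ}
    (hf : f ≠ 0) : ∃ v ∈ Matrix.unitaryGroup n ℂ, ∃ c : ℂ, c ≠ 0 ∧ f = c • v *ᵥ Pi.single i 1 := by
  set g : EuclideanSpace ℂ n := WithLp.toLp 2 f with hg
  have hg0 : g ≠ 0 := fun h => hf (by simpa [hg] using h)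
  have hn : (‖g‖ : ℂ) ≠ 0 := by simpa using hg0
  obtain ⟨b, hb⟩ := Orthonormal.exists_orthonormalBasis_extension_of_card_eq (𝕜 := ℂ) (ι := n)
    (E := EuclideanSpace ℂ n) (by simp) (v := fun _ => (‖g‖ : ℂ)⁻¹ • g) (s := {i}) (by
      constructor
      · rintro ⟨j, hj⟩
        simp [norm_smul, hg0]
      · rintro ⟨j, hj⟩ ⟨k, hk⟩ hjk
        rw [Set.mem_singleton_iff] at hj hk
        exact absurd (Subtype.ext (hj.trans hk.symm)) hjk)
  refine ⟨_, (EuclideanSpace.basisFun n ℂ).toMatrix_orthonormalBasis_mem_unitary b,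
    ‖g‖, hn, ?_⟩
  ext j
  have := hb i rfl
  simp only [EuclideanSpace.basisFun_toBasis, Matrix.mulVec_single_one, Pi.smul_apply,
    Matrix.col_apply, Module.Basis.toMatrix_apply, this, smul_eq_mul]
  simp [hn]
  rfl

/-- Unit quaternions act transitively on the lines of `ℂ²`. -/
theorem exists_unitary_quat {k : Fin 2 → ℂ} (hk : k ≠ 0) :
    ∃ u ∈ unitary ℍ[ℝ], ∃ c : ℂ, c ≠ 0 ∧ k = c • quatToMatrix u *ᵥ Pi.single 1 1 := by
  set q : ℍ[ℝ] := ⟨(k 1).re, -(k 1).im, (k 0).re, (k 0).im⟩ with hq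
  have hq0 : q ≠ 0 := by
    intro h
    apply hk
    rw [Quaternion.ext_iff] at h
    simp [hq] at h
    ext i
    fin_cases i <;> simp [Complex.ext_iff, h]
  have hn : ‖q‖ ≠ 0 := norm_ne_zero_iff.2 hq0
  refine ⟨‖q‖⁻¹ • q, ?_, ‖q‖, by exact_mod_cast hn, ?_⟩
  · rw [Unitary.mem_iff]
    have e : ∀ r : ℝ, ((r * r * Quaternion.normSq q : ℝ) : ℍ[ℝ]) =
      (r • star q) * (r • q) := by
      intro r
      rw [smul_mul_smul_comm, Quaternion.star_mul_self, ← Quaternion.coe_smul, smul_eq_mul]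
    have e' : ∀ r : ℝ, ((r * r * Quaternion.normSq q : ℝ) : ℍ[ℝ]) =
      (r • q) * (r • star q) := by
      intro r
      rw [smul_mul_smul_comm, Quaternion.self_mul_star, ← Quaternion.coe_smul, smul_eq_mul]
    have h1 : ‖q‖⁻¹ * ‖q‖⁻¹ * Quaternion.normSq q = 1 := by
      rw [Quaternion.normSq_eq_norm_mul_self]; field_simp
    rw [Quaternion.star_smul, ← e, ← e', h1]
    simp
  · rw [map_smul]
    ext i
    fin_cases i <;> simp [quatToMatrix, hq] <;> rw [← mul_assoc] <;>
      rw [mul_inv_cancel₀ (by exact_mod_cast hn)] <;> simp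

open scoped ComplexOrder in
/-- For an injective `A` the columns of `N` are a basis of the orthogonal complement of the range of
`A`; a matrix that vanishes on the range and maps into the complement is determined by its
compression to the complement. -/
theorem exists_complement {A : Matrix (Fin 4) (Fin 2) ℂ} (hA : ∀ x, A *ᵥ x = 0 → x = 0) :
    ∃ N : Matrix (Fin 4) (Fin 2) ℂ, ∀ m : Matrix (Fin 4) (Fin 4) ℂ,
      m * A = 0 → Aᴴ * m = 0 → Nᴴ * m * N = 0 → m = 0 := by
  have hinj : Function.Injective A.mulVecLin := by
    rw [← LinearMap.ker_eq_bot, LinearMap.ker_eq_bot']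
    exact hA
  have hr : Module.finrank ℂ (LinearMap.range A.mulVecLin) = 2 := by
    rw [LinearMap.finrank_range_of_inj hinj]; simp
  have hr' : Module.finrank ℂ (LinearMap.range Aᴴ.mulVecLin) = 2 := by
    exact (Matrix.rank_conjTranspose A).trans hr
  have hk : Module.finrank ℂ (LinearMap.ker Aᴴ.mulVecLin) = 2 := by
    have := LinearMap.finrank_range_add_finrank_ker Aᴴ.mulVecLin
    rw [hr', Module.finrank_fintype_fun_eq_card, Fintype.card_fin] at this
    omega
  have hdis : LinearMap.range A.mulVecLin ⊓ LinearMap.ker Aᴴ.mulVecLin = ⊥ := by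
    rw [eq_bot_iff]
    rintro _ ⟨⟨x, rfl⟩, hx⟩
    have hx' : (Aᴴ * A) *ᵥ x = 0 := by
      rw [← Matrix.mulVec_mulVec]
      exact hx
    rw [Matrix.conjTranspose_mul_self_mulVec_eq_zero] at hx'
    exact hx'
  have htop : LinearMap.range A.mulVecLin ⊔ LinearMap.ker Aᴴ.mulVecLin = ⊤ := by
    apply Submodule.eq_top_of_finrank_eq
    have := Submodule.finrank_sup_add_finrank_inf_eq (LinearMap.range A.mulVecLin)
      (LinearMap.ker Aᴴ.mulVecLin)
    rw [hdis, hr, hk, finrank_bot] at this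
    rw [Module.finrank_fintype_fun_eq_card, Fintype.card_fin]
    omega
  let b := Module.finBasisOfFinrankEq ℂ _ hk
  let N : Matrix (Fin 4) (Fin 2) ℂ := Matrix.of fun i j => (b j).1 i
  have hdec : ∀ x : Fin 4 → ℂ, ∃ y z, x = A *ᵥ y + N *ᵥ z := by
    intro x
    have hx : x ∈ LinearMap.range A.mulVecLin ⊔ LinearMap.ker Aᴴ.mulVecLin := htop ▸ trivial
    obtain ⟨_, ⟨y, rfl⟩, n, hn, rfl⟩ := Submodule.mem_sup.1 hx
    refine ⟨y, b.repr ⟨n, hn⟩, ?_⟩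
    rw [Matrix.mulVecLin_apply]
    congr 1
    have := congrArg Subtype.val (b.sum_repr ⟨n, hn⟩)
    refine this.symm.trans ?_
    ext i
    simp only [N, Matrix.mulVec, dotProduct, Matrix.of_apply, Submodule.coe_sum,
      Submodule.coe_smul, Finset.sum_apply, Pi.smul_apply, smul_eq_mul]
    exact Finset.sum_congr rfl fun j _ => mul_comm _ _
  have hzero : ∀ {m : Matrix (Fin 4) (Fin 4) ℂ}, m * A = 0 → m * N = 0 → m = 0 := by
    intro m h1 h2
    apply Matrix.ext_of_mulVec_single
    intro i
    obtain ⟨y, z, h⟩ := hdec (Pi.single i 1)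
    rw [h, Matrix.mulVec_add, Matrix.mulVec_mulVec, Matrix.mulVec_mulVec, h1, h2]
    simp
  have hzero' : ∀ {X : Matrix (Fin 4) (Fin 2) ℂ}, Aᴴ * X = 0 → Nᴴ * X = 0 → X = 0 := by
    intro X h1 h2
    have h1' : Xᴴ * A = 0 := by simpa using congrArg Matrix.conjTranspose h1
    have h2' : Xᴴ * N = 0 := by simpa using congrArg Matrix.conjTranspose h2
    rw [← Matrix.self_mul_conjTranspose_eq_zero]
    apply hzero <;> rw [Matrix.mul_assoc] <;> simp [h1', h2']
  refine ⟨N, fun m h1 h2 h3 => hzero h1 (hzero' ?_ ?_)⟩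
  · rw [← Matrix.mul_assoc, h2, Matrix.zero_mul]
  · rw [← Matrix.mul_assoc, h3]

/-- If the intertwiner is injective, `(p, q, m)` is determined by `p`, `q` and the compression of `m`
to the orthogonal complement of the range of `A`. -/
theorem finrank_le_of_injective_intertwiner {B : NonUnitalStarSubalgebra ℝ EvenAlg}
    {A : Matrix (Fin 4) (Fin 2) ℂ} (hA : ∀ x, A *ᵥ x = 0 → x = 0)
    (h : ∀ b ∈ B, A * quatToMatrix b.1 = b.2.2 * A) : Module.finrank ℝ B ≤ 16 := by
  obtain ⟨N, hN⟩ := exists_complement hA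
  let F : B →ₗ[ℝ] ℍ[ℝ] × ℍ[ℝ] × Matrix (Fin 2) (Fin 2) ℂ :=
    { toFun := fun b => (b.1.1, b.1.2.1, Nᴴ * b.1.2.2 * N)
      map_add' := fun b c => by simp [Matrix.mul_add, Matrix.add_mul]
      map_smul' := fun r b => by simp }
  have hF : Function.Injective F := by
    rw [← LinearMap.ker_eq_bot, LinearMap.ker_eq_bot']
    rintro ⟨⟨p, q, m⟩, hb⟩ h0
    obtain ⟨rfl, rfl, h3⟩ : p = 0 ∧ q = 0 ∧ Nᴴ * m * N = 0 := by simpa [F] using h0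
    have h1 : m * A = 0 := by simpa using (h _ hb).symm
    have h2 : mᴴ * A = 0 := by
      simpa [Matrix.star_eq_conjTranspose] using (h _ (star_mem hb)).symm
    have h2' : Aᴴ * m = 0 := by simpa using congrArg Matrix.conjTranspose h2
    have := hN m h1 h2' h3
    subst this
    rfl
  have := LinearMap.finrank_le_finrank_of_injective hF
  simpa [Module.finrank_prod, Quaternion.finrank_eq_four, Module.finrank_matrix] using this

/-- If the intertwiner is not injective, it has rank one, and an inner automorphism that moves the
orthogonal complement of its kernel and its range to the lines of the first basis vectors carries
`B` into `A_F`. -/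
theorem exists_automorphism_of_intertwiner {B : NonUnitalStarSubalgebra ℝ EvenAlg}
    {A : Matrix (Fin 4) (Fin 2) ℂ} (hA : A ≠ 0) {k : Fin 2 → ℂ} (hk : k ≠ 0) (hAk : A *ᵥ k = 0)
    (h : ∀ b ∈ B, A * quatToMatrix b.1 = b.2.2 * A) :
    ∃ φ : EvenAlg ≃⋆ₐ[ℝ] EvenAlg, ∀ b ∈ B, φ b ∈ AF := by
  obtain ⟨u, hu, c, hc, rfl⟩ := exists_unitary_quat hk
  have hu' := Unitary.mem_iff.1 hu
  have hMu : quatToMatrix u * (quatToMatrix u)ᴴ = 1 := by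
    rw [← Matrix.star_eq_conjTranspose, ← map_star, ← map_mul, hu'.2, map_one]
  have hz : (A * quatToMatrix u) *ᵥ Pi.single 1 1 = 0 := by
    rw [Matrix.mulVec_smul, smul_eq_zero_iff_right hc, Matrix.mulVec_mulVec] at hAk
    exact hAk
  set A' := A * quatToMatrix u with hA'
  set f : Fin 4 → ℂ := A' *ᵥ Pi.single 0 1 with hf
  have hf0 : f ≠ 0 := by
    intro h0
    apply hA
    have : A' = 0 := by
      ext i j
      fin_cases j
      · simpa [hf] using congrFun h0 i
      · simpa using congrFun hz i
    rw [← Matrix.mul_one A, ← hMu, ← Matrix.mul_assoc, ← hA', this, Matrix.zero_mul]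
  obtain ⟨v, hv, d, hd, hfv⟩ := exists_unitary_col 0 hf0
  have hv' := Unitary.mem_iff.1 hv
  have hw : (star u, (1 : ℍ[ℝ]), star v) ∈ unitary EvenAlg := by
    rw [Unitary.mem_iff]
    simp [Prod.ext_iff, hu', hv']
  refine ⟨Unitary.conjStarAlgAut ℝ EvenAlg ⟨_, hw⟩, ?_⟩
  -- `A' = A u` is supported in its first column, which spans the line of the first column of `v`
  have key : ∀ b ∈ B, (quatToMatrix (star u * b.1 * u)) 0 1 = 0 ∧ ∀ i,
      (star v * b.2.2 * v) i 0 = if i = 0 then (quatToMatrix (star u * b.1 * u)) 0 0 else 0 := by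
    intro b hb
    set P := quatToMatrix (star u * b.1 * u) with hP
    have e1 : A' * P = b.2.2 * A' := by
      rw [hP, map_mul, map_mul, map_star, Matrix.star_eq_conjTranspose, hA', ← Matrix.mul_assoc b.2.2,
        ← h b hb]
      calc _ = A * (quatToMatrix u * (quatToMatrix u)ᴴ) * quatToMatrix b.1 * quatToMatrix u := by
            simp only [Matrix.mul_assoc]
        _ = _ := by rw [hMu, Matrix.mul_one]
    have c1 : ∀ i, A' i 1 = 0 := fun i => by simpa using congrFun hz i
    have c0 : ∀ i, A' i 0 = d * v i 0 := fun i => by simpa [hf] using congrFun hfv i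
    constructor
    · obtain ⟨i, hi⟩ := Function.ne_iff.1 hf0
      have := congrFun₂ e1 i 1
      simp only [Matrix.mul_apply, Fin.sum_univ_two, c1, mul_zero, zero_mul, add_zero,
        Finset.sum_const_zero] at this
      exact (mul_eq_zero.1 this).resolve_left (by simpa [hf] using hi)
    · intro i
      have hmv : ∀ j, (b.2.2 * v) j 0 = v j 0 * P 0 0 := by
        intro j
        have := congrFun₂ e1 j 0
        simp only [Matrix.mul_apply, Fin.sum_univ_two, c1, c0, zero_mul, add_zero] at this
        apply mul_left_cancel₀ hd
        rw [Matrix.mul_apply, Finset.mul_sum, ← mul_assoc, this]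
        exact Finset.sum_congr rfl fun k _ => by ring
      rw [mul_assoc, Matrix.mul_apply]
      simp only [hmv, ← mul_assoc, ← Finset.sum_mul]
      rw [← Matrix.mul_apply, hv'.1, Matrix.one_apply, ite_mul, one_mul, zero_mul]
  rintro b hb
  refine ⟨(⟨(star u * b.1 * u).re, (star u * b.1 * u).imI⟩, b.2.1,
    (star v * b.2.2 * v).submatrix Fin.succ Fin.succ), ?_⟩
  obtain ⟨k1, k2⟩ := key b hb
  obtain ⟨-, k3⟩ := key _ (star_mem hb)
  have k4 : ∀ j, (star v * b.2.2 * v) 0 j =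
      if j = 0 then quatToMatrix (star u * b.1 * u) 0 0 else 0 := by
    intro j
    have e1 : star v * (star b).2.2 * v = star (star v * b.2.2 * v) := by
      simp [mul_assoc]
    have e2 : star u * (star b).1 * u = star (star u * b.1 * u) := by
      simp [mul_assoc]
    have := k3 j
    rw [e1, e2, map_star, Matrix.star_apply, Matrix.star_apply] at this
    rw [← star_star ((star v * b.2.2 * v) 0 j), this]
    split_ifs <;> simp
  refine Prod.ext ?_ (Prod.ext ?_ ?_)
  · simp [quatToMatrix, Complex.ext_iff] at k1
    simp [smIncl, Quaternion.ext_iff, k1]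
  · simp [smIncl]
  · have e : (Unitary.conjStarAlgAut ℝ EvenAlg ⟨_, hw⟩ b).2.2 = star v * b.2.2 * v := by
      simp
    rw [e]
    ext i j
    change oplus _ _ i j = _
    cases i using Fin.cases with
    | zero =>
      rw [oplus_apply_zero, k4]
      rfl
    | succ i =>
      cases j using Fin.cases with
      | zero => rw [oplus_apply_succ_zero, k2, if_neg (Fin.succ_ne_zero i)]
      | succ j => rw [oplus_apply_succ_succ]; rfl

/-- Interchange of the two quaternionic summands. -/
def swapQuat : EvenAlg ≃⋆ₐ[ℝ] EvenAlg where
  toFun a := (a.2.1, a.1, a.2.2)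
  invFun a := (a.2.1, a.1, a.2.2)
  left_inv _ := rfl
  right_inv _ := rfl
  map_mul' _ _ := rfl
  map_add' _ _ := rfl
  map_smul' _ _ := rfl
  map_star' _ := rfl

/-- The dichotomy for subalgebras admitting off-diagonal Dirac operators: they are of dimension at most
`16`, or conjugate to a subalgebra of `A_F`. -/
theorem finrank_le_or_exists_automorphism {B : NonUnitalStarSubalgebra ℝ EvenAlg}
    (hB : AdmitsOffDiagonal B) : Module.finrank ℝ B ≤ 16 ∨
      ∃ φ : EvenAlg ≃⋆ₐ[ℝ] EvenAlg, ∀ b ∈ B, φ b ∈ AF := by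
  have first : ∀ (C : NonUnitalStarSubalgebra ℝ EvenAlg) (A : Matrix (Fin 4) (Fin 2) ℂ), A ≠ 0 →
      (∀ b ∈ C, A * quatToMatrix b.1 = b.2.2 * A) → Module.finrank ℝ C ≤ 16 ∨
      ∃ φ : EvenAlg ≃⋆ₐ[ℝ] EvenAlg, ∀ b ∈ C, φ b ∈ AF := by
    intro C A hA h
    by_cases hk : ∀ x, A *ᵥ x = 0 → x = 0
    · exact Or.inl (finrank_le_of_injective_intertwiner hk h)
    · push Not at hk
      obtain ⟨k, hAk, hk⟩ := hk
      exact Or.inr (exists_automorphism_of_intertwiner hA hk hAk h)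
  obtain ⟨A, hA, h | h⟩ := exists_intertwiner hB
  · exact first B A hA h
  · have := first (B.map (swapQuat : EvenAlg →⋆ₙₐ[ℝ] EvenAlg)) A hA (by
      rintro _ ⟨b, hb, rfl⟩
      exact h b hb)
    rcases this with h | ⟨φ, hφ⟩
    · left
      have e : Module.finrank ℝ (B.map (swapQuat : EvenAlg →⋆ₙₐ[ℝ] EvenAlg)) =
        Module.finrank ℝ B :=
          LinearEquiv.finrank_map_eq (swapQuat.toAlgEquiv.toLinearEquiv) B.toSubmodule
      omega
    · exact Or.inr ⟨swapQuat.trans φ, fun b hb => hφ _ ⟨b, hb, rfl⟩⟩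

theorem finrank_le_of_map_mem {B : NonUnitalStarSubalgebra ℝ EvenAlg}
    {φ : EvenAlg ≃⋆ₐ[ℝ] EvenAlg} (hφ : ∀ b ∈ B, φ b ∈ AF) : Module.finrank ℝ B ≤ 24 ∧
      (Module.finrank ℝ B = 24 → (B : Set EvenAlg) = φ.symm '' AF) := by
  have hle : B.toSubmodule.map (φ.toAlgEquiv.toLinearEquiv : EvenAlg →ₗ[ℝ] EvenAlg) ≤
      AF.toNonUnitalStarSubalgebra.toSubmodule := by
    rintro _ ⟨b, hb, rfl⟩
    exact hφ b hb
  have e : Module.finrank ℝ (B.toSubmodule.map (φ.toAlgEquiv.toLinearEquiv : EvenAlg →ₗ[ℝ] EvenAlg))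
    = Module.finrank ℝ B := LinearEquiv.finrank_map_eq _ _
  have e2 : Module.finrank ℝ AF.toNonUnitalStarSubalgebra.toSubmodule = 24 := finrank_AF
  refine ⟨?_, fun h24 => ?_⟩
  · rw [← e, ← e2]; exact Submodule.finrank_mono hle
  · have := Submodule.eq_of_le_of_finrank_eq hle (by rw [e, e2, h24])
    ext b
    constructor
    · intro hb
      exact ⟨φ b, hφ b hb, φ.symm_apply_apply b⟩
    · rintro ⟨a, ha, rfl⟩
      have ha' : a ∈ AF.toNonUnitalStarSubalgebra.toSubmodule := ha
      rw [← this] at ha'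
      obtain ⟨b, hb, rfl⟩ := ha'
      have : φ.symm (φ b) = b := φ.symm_apply_apply b
      rw [show (φ.toAlgEquiv.toLinearEquiv : EvenAlg →ₗ[ℝ] EvenAlg) b = φ b from rfl, this]
      exact hb

/-! ### The geometry of one generation -/

theorem quatToMatrix_ofComplex (l : ℂ) :
    quatToMatrix (Quaternion.ofComplex l) = !![l, 0; 0, conj l] := by
  ext i j
  fin_cases i <;> fin_cases j <;> simp [quatToMatrix, Complex.ext_iff]

theorem sum_isospin (F : Isospin → ℂ) : ∑ k, F k = F .up + F .down := by
  rw [show Finset.univ = ({.up, .down} : Finset Isospin) from rfl, Finset.sum_pair (by decide)]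

/-- The matching of matrix units and fermions: the quaternionic coordinate of `W` is the chirality (first
line right, second line left), the coordinate inside a line is the isospin, and the coordinate of `V`
is the flavor, with `0` for the lepton. Elements of `Hom(V, W)` are particles and elements of
`Hom(W, V)` are antiparticles. -/
def fermionEquiv : HIdx ≃ Fermion where
  toFun
    | .inl ((s, k), v) => .particle (![.right, .left] s) (![.up, .down] k)
        (Fin.cases .lepton .quark v)
    | .inr (v, (s, k)) => .anti (![.right, .left] s) (![.up, .down] k)
        (Fin.cases .lepton .quark v)
  invFun
    | .particle χ i f => .inl ((match χ with | .right => 0 | .left => 1, i.toFin),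
        match f with | .lepton => 0 | .quark c => c.succ)
    | .anti χ i f => .inr (match f with | .lepton => 0 | .quark c => c.succ,
        (match χ with | .right => 0 | .left => 1, i.toFin))
  left_inv := by
    rintro (⟨⟨s, k⟩, v⟩ | ⟨v, ⟨s, k⟩⟩) <;> fin_cases s <;> fin_cases k <;> fin_cases v <;> rfl
  right_inv := by
    rintro (⟨_ | _, _ | _, _ | _⟩ | ⟨_ | _, _ | _, _ | _⟩) <;> rfl

/-- The unitary from the Hilbert space onto that of one generation given by `fermionEquiv`. -/
def fermionIso : HSpace ≃ₗᵢ[ℂ] SMSpace :=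
  LinearIsometryEquiv.piLpCongrLeft 2 ℂ ℂ fermionEquiv

theorem fermionIso_apply (ξ : HSpace) (f : Fermion) :
    fermionIso ξ f = ξ (fermionEquiv.symm f) := rfl

theorem fermionIso_J (ξ : HSpace) : fermionIso (J ξ) = smJ (fermionIso ξ) := by
  ext f
  rcases f with ⟨χ, i, f⟩ | ⟨χ, i, f⟩ <;> rfl

theorem fermionIso_γ (ξ : HSpace) : fermionIso (γ ξ) = smγ (fermionIso ξ) := by
  ext f
  rw [fermionIso_apply]
  rcases f with ⟨_ | _, i, f⟩ | ⟨_ | _, i, f⟩ <;>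
    simp [smγ, γ, fermionIso_apply, Matrix.mulVec_diagonal, fermionEquiv, gradingW, Chirality.sign]

theorem repEv_apply_inl (a : EvenAlg) (ξ : HSpace) (s k : Fin 2) (v : VIdx) :
    repEv a ξ (Sum.inl ((s, k), v)) =
      ∑ l, quatToMatrix (![a.1, a.2.1] s) k l * ξ (Sum.inl ((s, l), v)) := by
  change Matrix.toEuclideanCLM (𝕜 := ℂ) (leftMulMatrix (evenIncl a)) ξ _ = _
  simp [leftMulMatrix, Matrix.mulVec, dotProduct, Fintype.sum_sum_type, Matrix.one_apply]
  simp only [Fintype.sum_prod_type (α₂ := VIdx)]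
  rw [Fintype.sum_prod_type, Finset.sum_eq_single s]
  · simp [quatMatrixToMatrix_apply, evenIncl]
  · intro t _ ht
    simp [quatMatrixToMatrix_apply, evenIncl, Matrix.diagonal_apply_ne _ ht.symm]
  · simp

theorem repEv_apply_inr (a : EvenAlg) (ξ : HSpace) (v : VIdx) (w : WIdx) :
    repEv a ξ (Sum.inr (v, w)) = ∑ u, a.2.2 v u * ξ (Sum.inr (u, w)) := by
  change Matrix.toEuclideanCLM (𝕜 := ℂ) (leftMulMatrix (evenIncl a)) ξ _ = _
  simp [leftMulMatrix, Matrix.mulVec, dotProduct, Fintype.sum_sum_type, Matrix.one_apply]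
  simp only [Fintype.sum_prod_type (α₂ := WIdx)]
  simp [evenIncl]

theorem fermionIso_rep (a : SMAlg) (ξ : HSpace) :
    fermionIso (repEv (smIncl a) ξ) = smAction a (fermionIso ξ) := by
  ext f
  rw [fermionIso_apply]
  rcases f with ⟨_ | _, i, f⟩ | ⟨χ, i, _ | c⟩
  · refine ((repEv_apply_inl _ ξ _ _ _).trans (Fin.sum_univ_two _)).trans ?_
    cases i <;> simp only [smAction, sum_isospin] <;> rfl
  · refine ((repEv_apply_inl _ ξ _ _ _).trans (Fin.sum_univ_two _)).trans ?_
    change quatToMatrix (Quaternion.ofComplex a.1) i.toFin 0 * _ +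
      quatToMatrix (Quaternion.ofComplex a.1) i.toFin 1 * _ = _
    rw [quatToMatrix_ofComplex]
    cases i
    · simp [smAction, Isospin.toFin]
      exact Or.inl rfl
    · simp [smAction, Isospin.toFin]
      exact Or.inl rfl
  · refine (repEv_apply_inr _ ξ _ _).trans ?_
    simp [smAction, smIncl, oplus_apply_zero]
    exact Or.inl rfl
  · refine (repEv_apply_inr _ ξ _ _).trans ?_
    rw [Fin.sum_univ_succ]
    simp only [smIncl, StarAlgHom.coe_mk', AlgHom.coe_mk, RingHom.coe_mk, MonoidHom.coe_mk,
      OneHom.coe_mk, oplus_apply_succ_zero, oplus_apply_succ_succ, zero_mul, zero_add]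
    rfl

end FiniteGeometry

end

theorem theorem3 :
    -- the subalgebra admits off-diagonal Dirac operators and has maximal dimension among those
    FiniteGeometry.IsMaximalAdmissible FiniteGeometry.AF.toNonUnitalStarSubalgebra ∧
    -- uniqueness up to an automorphism
    (∀ B : NonUnitalStarSubalgebra ℝ FiniteGeometry.EvenAlg,
      FiniteGeometry.IsMaximalAdmissible B →
        ∃ φ : FiniteGeometry.EvenAlg ≃⋆ₐ[ℝ] FiniteGeometry.EvenAlg,
          (B : Set FiniteGeometry.EvenAlg) = φ '' (FiniteGeometry.AF : Set FiniteGeometry.EvenAlg)) ∧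
    -- the explicit form of the subalgebra, and its identification, together with the
    -- representation, real structure and grading, with the Standard Model geometry
    ∃ (ψ : FiniteGeometry.AF ≃⋆ₐ[ℝ] ℂ × Quaternion ℝ × Matrix (Fin 3) (Fin 3) ℂ)
      (U : FiniteGeometry.HSpace ≃ₗᵢ[ℂ] FiniteGeometry.SMSpace),
      (∀ (a : FiniteGeometry.AF) (ξ : FiniteGeometry.HSpace),
        U (FiniteGeometry.repEv a ξ) = FiniteGeometry.smAction (ψ a) (U ξ)) ∧
      (∀ ξ : FiniteGeometry.HSpace, U (FiniteGeometry.J ξ) = FiniteGeometry.smJ (U ξ)) ∧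
      (∀ ξ : FiniteGeometry.HSpace, U (FiniteGeometry.γ ξ) = FiniteGeometry.smγ (U ξ)) := by
  open FiniteGeometry in
  refine ⟨⟨admitsOffDiagonal_AF, fun C hC => ?_⟩, fun B hB => ?_,
    (StarAlgEquiv.ofInjective smIncl smIncl_injective).symm, fermionIso, ?_,
    fermionIso_J, fermionIso_γ⟩
  · rw [finrank_AF]
    rcases finrank_le_or_exists_automorphism hC with h | ⟨φ, hφ⟩
    · omega
    · exact (finrank_le_of_map_mem hφ).1
  · have h24 := hB.2 _ admitsOffDiagonal_AF
    rw [finrank_AF] at h24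
    rcases finrank_le_or_exists_automorphism hB.1 with h | ⟨φ, hφ⟩
    · omega
    · have := finrank_le_of_map_mem hφ
      exact ⟨φ.symm, this.2 (by omega)⟩
  · intro a ξ
    obtain ⟨a, rfl⟩ := (StarAlgEquiv.ofInjective smIncl smIncl_injective).surjective a
    have h := (StarAlgEquiv.ofInjective smIncl smIncl_injective).symm_apply_apply a
    exact (fermionIso_rep a ξ).trans (congrArg (smAction · (fermionIso ξ)) h.symm)
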